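/- Let $d,N\in\mathbb N_0$ and $\kappa=(\kappa_1,\dots,\kappa_{d+1})\in\mathbb R^{d+1}$ with $\kappa_i>-1$ for all $i$. Write $|\kappa|=\sum_i\kappa_i$, $(a)_n=a(a+1)\cdots(a+n-1)$, and, for $\alpha\in\mathbb N_0^{d+1}$, $|\alpha|=\sum_i\alpha_i$, $\alpha!=\prod_i\alpha_i!$, $(\kappa+\mathbf 1)_\alpha=\prod_i(\kappa_i+1)_{\alpha_i}$. Let $\mathbb Z_m^{d+1}=\{\alpha\in\mathbb N_0^{d+1}:|\alpha|=m\}$. Let $\Pi_n^d$ be the space of real polynomials of total degree at most $n$ in $x_1,\dots,x_d$ (with $\Pi_{-1}^d=\{0\}$), evaluated at $x\in\mathbb Z_N^{d+1}$ through its first $d$ coordinates, with $$\langle f,g\rangle=\frac{N!}{(|\kappa|+d+1)_N}\sum_{x\in\mathbb Z_N^{d+1}}f(x)g(x)\frac{(\kappa+\mathbf 1)_x}{x!},$$ which is an inner product on $\Pi_N^d$. For $0\le n\le N$ let $\mathcal V_n^d=\{p\in\Pi_n^d:\langle p,q\rangle=0\ \text{for all } q\in\Pi_{n-1}^d\}$.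 For $\alpha\in\mathbb N_0^{d+1}$ with $n\le|\alpha|\le N$ let $$\mathrm m_\alpha(x)=(-1)^{|\alpha|}\prod_{i=1}^{d+1}(-x_i)_{\alpha_i},\quad x_{d+1}:=N-x_1-\cdots-x_d,\qquad \mathsf Q_{\alpha,n}=\frac1{(\kappa+\mathbf 1)_\alpha}\,\mathrm{proj}_{\mathcal V_n^d}\,\mathrm m_\alpha ,$$ where $\mathrm{proj}_{\mathcal V_n^d}$ is the orthogonal projection of $\Pi_N^d$ onto $\mathcal V_n^d$, and for $n\le m\le N$ let $$\mathsf D_n(m,N)=\frac{(-N)_n\,m!\,(|\kappa|+d+1)_N\,(|\kappa|+d+1)_{m+n}}{(-m)_n\,[(-N)_m]^2\,(|\kappa|+d+1)_{N+n}} .$$ **Theorem.** For any integers $m_1,\dots,m_N$ with $n\le m_n\le N$ for $1\le n\le N$, the following hold. 1. For every $f\in\Pi_N^d$, as polynomials, $$f=\langle f,1\rangle+\sum_{n=1}^N\mathsf D_n(m_n,N)\sum_{|\alpha|=m_n}\frac{(\kappa+\mathbf 1)_\alpha}{\alpha!}\,\langle f,\mathsf Q_{\alpha,n}\rangle\,\mathsf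 Q_{\alpha,n}.$$ 2. For every $f\in\Pi_N^d$, $$\langle f,f\rangle=\langle f,1\rangle^2+\sum_{n=1}^N\mathsf D_n(m_n,N)\sum_{|\alpha|=m_n}\frac{(\kappa+\mathbf 1)_\alpha}{\alpha!}\,\langle f,\mathsf Q_{\alpha,n}\rangle^2.$$ 3. All the coefficients $\mathsf D_n(m_n,N)(\kappa+\mathbf 1)_\alpha/\alpha!$ occurring here are positive, and $\{1\}\cup\{\mathsf Q_{\alpha,n}:1\le n\le N,\ |\alpha|=m_n\}$, each $\mathsf Q_{\alpha,n}$ being scaled by the square root of its coefficient, is a (Parseval) tight frame $(v_k)$ of $\Pi_N^d$: all $v_k\in\Pi_N^d$, and $\langle f,f\rangle=\sum_k\langle f,v_k\rangle^2$ for all $f\in\Pi_N^d$. -/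

import Mathlib

open MvPolynomial

namespace HahnFrame

/-- The Pochhammer symbol `(a)ₙ = a (a + 1) ⋯ (a + n - 1)` in a commutative ring. -/
noncomputable def poch {R : Type*} [CommRing R] (a : R) (n : ℕ) : R :=
  (ascPochhammer R n).eval a

/-- The set `ℤ_N^{d+1}` of multi-indices `α ∈ ℕ₀^{d+1}` with `|α| = α₁ + ⋯ + α_{d+1} = N`. -/
def lattice (d N : ℕ) : Finset (Fin (d + 1) → ℕ) :=
  Finset.piAntidiag Finset.univ N

/-- `Π_N^d`: real polynomials in `d` variables of total degree at most `N`. -/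
noncomputable abbrev polySpace (d N : ℕ) : Submodule ℝ (MvPolynomial (Fin d) ℝ) :=
  restrictTotalDegree (Fin d) ℝ N

/-- The value of a polynomial in `d` variables at a point given in homogeneous coordinates
`x = (x₁, …, x_{d+1})`, `|x| = N`; the polynomial sees `(x₁, …, x_d)`. -/
noncomputable def evalAt {d : ℕ} (x : Fin (d + 1) → ℕ) (f : MvPolynomial (Fin d) ℝ) : ℝ :=
  eval (fun i : Fin d => (x i.castSucc : ℝ)) f

/-- `|κ| + d + 1`. -/
noncomputable def lam {d : ℕ} (κ : Fin (d + 1) → ℝ) : ℝ := (∑ i, κ i) + d + 1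

/-- The Hahn weight `H_κ(α) = (κ + 1)_α / α!`. -/
noncomputable def weight {d : ℕ} (κ : Fin (d + 1) → ℝ) (α : Fin (d + 1) → ℕ) : ℝ :=
  (∏ i, poch (κ i + 1) (α i)) / (∏ i, ((α i).factorial : ℝ))

/-- The Hahn inner product
`⟨f, g⟩ = N! / (|κ| + d + 1)_N * ∑_{|x| = N} f(x) g(x) H_κ(x)`. -/
noncomputable def inner {d : ℕ} (κ : Fin (d + 1) → ℝ) (N : ℕ) (f g : MvPolynomial (Fin d) ℝ) : ℝ :=
  (N.factorial : ℝ) / poch (lam κ) N *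
    ∑ x ∈ lattice d N, evalAt x f * evalAt x g * weight κ x

/-- The homogeneous coordinates as polynomials in `d` variables:
`x₁, …, x_d` and `x_{d+1} = N - x₁ - ⋯ - x_d`. -/
noncomputable def coord (d N : ℕ) : Fin (d + 1) → MvPolynomial (Fin d) ℝ :=
  Fin.snoc (α := fun _ => MvPolynomial (Fin d) ℝ) X (C (N : ℝ) - ∑ i, X i)

/-- The shifted monic monomial `m_α(x) = (-1)^{|α|} (-x)_α`, as a polynomial in `d` variables
on the hyperplane `|x| = N`. -/
noncomputable def monicMonomial (d N : ℕ) (α : Fin (d + 1) → ℕ) : MvPolynomial (Fin d) ℝ :=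
  (-1) ^ (∑ i, α i) * ∏ i, poch (-coord d N i) (α i)

theorem inner_add_left {d : ℕ} (κ : Fin (d + 1) → ℝ) (N : ℕ) (f g h : MvPolynomial (Fin d) ℝ) :
    inner κ N (f + g) h = inner κ N f h + inner κ N g h := by
  simp only [inner, evalAt, map_add, add_mul, Finset.sum_add_distrib, mul_add]

theorem inner_smul_left {d : ℕ} (κ : Fin (d + 1) → ℝ) (N : ℕ) (c : ℝ)
    (f g : MvPolynomial (Fin d) ℝ) :
    inner κ N (c • f) g = c * inner κ N f g := by
  simp only [inner, evalAt, smul_eval, mul_assoc, ← Finset.mul_sum]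
  ring

theorem inner_comm {d : ℕ} (κ : Fin (d + 1) → ℝ) (N : ℕ) (f g : MvPolynomial (Fin d) ℝ) :
    inner κ N f g = inner κ N g f := by
  simp only [inner, mul_comm (evalAt _ f)]

/-- `⟨·, ·⟩` as a bilinear form. -/
noncomputable def innerForm {d : ℕ} (κ : Fin (d + 1) → ℝ) (N : ℕ) :
    LinearMap.BilinForm ℝ (MvPolynomial (Fin d) ℝ) :=
  LinearMap.mk₂ ℝ (inner κ N) (inner_add_left κ N) (inner_smul_left κ N)
    (fun f g h => by
      rw [inner_comm, inner_add_left, inner_comm κ N g, inner_comm κ N h])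
    (fun c f g => by rw [inner_comm, inner_smul_left, inner_comm κ N g, smul_eq_mul])

/-- `V_n^d`: the orthogonal polynomials of degree `n`, that is, the elements of `Π_n^d` that are
orthogonal to all polynomials of total degree less than `n` (for `n = 0` these are the
constants). -/
noncomputable def orthSpace {d : ℕ} (κ : Fin (d + 1) → ℝ) (N n : ℕ) :
    Submodule ℝ (MvPolynomial (Fin d) ℝ) where
  carrier := {p | p ∈ polySpace d n ∧ ∀ q, q.totalDegree < n → inner κ N p q = 0}
  zero_mem' := ⟨Submodule.zero_mem _, fun q _ => by simp [inner, evalAt]⟩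
  add_mem' := fun ha hb =>
    ⟨Submodule.add_mem _ ha.1 hb.1, fun q hq => by rw [inner_add_left, ha.2 q hq, hb.2 q hq, add_zero]⟩
  smul_mem' := fun c _ ha =>
    ⟨Submodule.smul_mem _ c ha.1, fun q hq => by rw [inner_smul_left, ha.2 q hq, mul_zero]⟩

/-- `q` is the orthogonal projection of `p` onto `V_n^d`. -/
def IsProj {d : ℕ} (κ : Fin (d + 1) → ℝ) (N n : ℕ) (p q : MvPolynomial (Fin d) ℝ) : Prop :=
  q ∈ orthSpace κ N n ∧ ∀ r ∈ orthSpace κ N n, inner κ N (p - q) r = 0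

open Classical in
/-- The orthogonal projection onto `V_n^d`. For `κ_i > -1`, `n ≤ N` it exists and is unique, see
`isProj_proj` and `IsProj.eq_proj` below (so the default value `0` is never used). -/
noncomputable def proj {d : ℕ} (κ : Fin (d + 1) → ℝ) (N n : ℕ) (p : MvPolynomial (Fin d) ℝ) :
    MvPolynomial (Fin d) ℝ :=
  if h : ∃ q, IsProj κ N n p q then h.choose else 0

/-- `Q_{α,n}(·; κ, N) = (κ + 1)_α⁻¹ proj_{V_n^d} m_α`. -/
noncomputable def hahnQ {d : ℕ} (κ : Fin (d + 1) → ℝ) (N : ℕ) (α : Fin (d + 1) → ℕ) (n : ℕ) :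
    MvPolynomial (Fin d) ℝ :=
  (∏ i, poch (κ i + 1) (α i))⁻¹ • proj κ N n (monicMonomial d N α)

/-- The constant `D_n(m, N)`. -/
noncomputable def constD {d : ℕ} (κ : Fin (d + 1) → ℝ) (n m N : ℕ) : ℝ :=
  (poch (-(N : ℝ)) n * (m.factorial : ℝ) * poch (lam κ) N * poch (lam κ) (m + n)) /
    (poch (-(m : ℝ)) n * (poch (-(N : ℝ)) m) ^ 2 * poch (lam κ) (N + n))

/-- A finite family `v` of vectors of `V` is a (Parseval) tight frame of `V` with respect to the
form `B` if `B f f = ∑ᵢ (B f vᵢ)²` for all `f ∈ V`. -/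
def IsTightFrame {E ι : Type*} [AddCommGroup E] [Module ℝ E] [Fintype ι] (B : E → E → ℝ)
    (V : Submodule ℝ E) (v : ι → E) : Prop :=
  (∀ i, v i ∈ V) ∧ ∀ f ∈ V, B f f = ∑ i, B f (v i) ^ 2

/-- The family consisting of `1` (index `none`) and, for `1 ≤ n ≤ N` and `|α| = m_n`, of the
polynomials `Q_{α,n}`, each scaled by the square root of its coefficient `D_n(m_n, N) (κ+1)_α / α!`.
The index `n` is stored as `n - 1 ∈ {0, …, N - 1}`. -/
noncomputable def frame {d : ℕ} (κ : Fin (d + 1) → ℝ) (N : ℕ) (m : ℕ → ℕ) :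
    Option ((n : Fin N) × lattice d (m (n + 1))) → MvPolynomial (Fin d) ℝ
  | none => 1
  | some ⟨n, α⟩ =>
      Real.sqrt (constD κ (n + 1) (m (n + 1)) N * weight κ α) • hahnQ κ N α (n + 1)

/-! ### The projection is well defined -/

theorem lam_pos {d : ℕ} {κ : Fin (d + 1) → ℝ} (hκ : ∀ i, -1 < κ i) : 0 < lam κ := by
  have h : 0 < ∑ i, (κ i + 1) :=
    Finset.sum_pos (fun i _ => by linarith [hκ i]) Finset.univ_nonempty
  rw [Finset.sum_add_distrib] at h
  simp at h
  rw [lam]; linarith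

theorem weight_pos {d : ℕ} {κ : Fin (d + 1) → ℝ} (hκ : ∀ i, -1 < κ i) (α : Fin (d + 1) → ℕ) :
    0 < weight κ α := by
  refine div_pos (Finset.prod_pos fun i _ => ascPochhammer_pos _ _ (by linarith [hκ i]))
    (Finset.prod_pos fun i _ => by positivity)

theorem mem_lattice {d N : ℕ} {α : Fin (d + 1) → ℕ} : α ∈ lattice d N ↔ ∑ i, α i = N := by
  simp [lattice, Finset.mem_piAntidiag]

theorem evalAt_coord {d N : ℕ} {x : Fin (d + 1) → ℕ} (hx : x ∈ lattice d N) (i : Fin (d + 1)) :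
    evalAt x (coord d N i) = x i := by
  rw [mem_lattice, Fin.sum_univ_castSucc] at hx
  refine Fin.lastCases ?_ (fun j => ?_) i
  · simp [evalAt, coord, ← hx]
  · simp [evalAt, coord]

theorem poch_map {R S : Type*} [CommRing R] [CommRing S] (φ : R →+* S) (a : R) (n : ℕ) :
    φ (poch a n) = poch (φ a) n := by
  induction n with
  | zero => simp [poch]
  | succ n ih =>
    simp only [poch] at ih ⊢
    rw [ascPochhammer_succ_eval, ascPochhammer_succ_eval, map_mul, ih, map_add, map_natCast]

theorem evalAt_monicMonomial {d N : ℕ} {x : Fin (d + 1) → ℕ} (hx : x ∈ lattice d N)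
    (α : Fin (d + 1) → ℕ) :
    evalAt x (monicMonomial d N α) = (-1) ^ (∑ i, α i) * ∏ i, poch (-(x i : ℝ)) (α i) := by
  have h : ∀ i, evalAt x (poch (-coord d N i) (α i)) = poch (-(x i : ℝ)) (α i) := by
    intro i
    rw [← evalAt_coord hx i]
    simp only [evalAt]
    rw [poch_map, map_neg]
  simp only [← h]
  simp [monicMonomial, evalAt, map_prod]

theorem totalDegree_poch_le {d : ℕ} {p : MvPolynomial (Fin d) ℝ} (hp : p.totalDegree ≤ 1) (n : ℕ) :
    (poch p n).totalDegree ≤ n := by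
  induction n with
  | zero => simp [poch]
  | succ n ih =>
    have : poch p (n + 1) = poch p n * (p + C (n : ℝ)) := by
      simp [poch, ascPochhammer_succ_eval]
    rw [this]
    refine (totalDegree_mul _ _).trans (add_le_add ih ?_)
    refine (totalDegree_add _ _).trans (max_le hp ?_)
    rw [totalDegree_C]; exact Nat.zero_le _

theorem totalDegree_coord_le (d N : ℕ) (i : Fin (d + 1)) : (coord d N i).totalDegree ≤ 1 := by
  refine Fin.lastCases ?_ (fun j => ?_) i
  · simp only [coord, Fin.snoc_last]
    refine (totalDegree_sub _ _).trans (max_le (by rw [totalDegree_C]; exact Nat.zero_le _) ?_)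
    exact totalDegree_finsetSum_le fun i _ => (totalDegree_X i).le
  · simp [coord]

theorem monicMonomial_mem {d : ℕ} (N : ℕ) (α : Fin (d + 1) → ℕ) :
    monicMonomial d N α ∈ polySpace d (∑ i, α i) := by
  rw [mem_restrictTotalDegree]
  have h1 : ((-1) ^ (∑ i, α i) : MvPolynomial (Fin d) ℝ) = C ((-1) ^ (∑ i, α i)) := by simp
  rw [monicMonomial, h1]
  refine (totalDegree_mul _ _).trans ?_
  rw [totalDegree_C, zero_add]
  refine (totalDegree_finsetProd _ _).trans (Finset.sum_le_sum fun i _ => ?_)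
  refine totalDegree_poch_le ?_ _
  rw [totalDegree_neg]; exact totalDegree_coord_le d N i

/-- A polynomial of total degree at most `N` is determined by its values on `ℤ_N^{d+1}`. -/
theorem eq_zero_of_evalAt {d N : ℕ} {f : MvPolynomial (Fin d) ℝ} (hf : f ∈ polySpace d N)
    (h : ∀ x ∈ lattice d N, evalAt x f = 0) : f = 0 := by
  classical
  let ev : polySpace d N →ₗ[ℝ] (lattice d N → ℝ) :=
    { toFun := fun p x => evalAt x.1 p.1
      map_add' := fun p q => by ext; simp [evalAt]
      map_smul' := fun c p => by ext; simp [evalAt, smul_eval] }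
  have hsurj : Function.Surjective ev := by
    rw [← LinearMap.range_eq_top, eq_top_iff, ← (Pi.basisFun ℝ (lattice d N)).span_eq,
      Submodule.span_le]
    rintro _ ⟨α, rfl⟩
    have hα : ∑ i, α.1 i = N := mem_lattice.1 α.2
    have hmem : monicMonomial d N α.1 ∈ polySpace d N := by
      have := monicMonomial_mem (d := d) N α.1
      rwa [hα] at this
    have hne : evalAt α.1 (monicMonomial d N α.1) ≠ 0 := by
      rw [evalAt_monicMonomial α.2]
      refine mul_ne_zero (by simp) (Finset.prod_ne_zero_iff.2 fun i _ => ?_)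
      rw [poch, Ne, ascPochhammer_eval_eq_zero_iff]
      rintro ⟨k, hk, hk'⟩
      simp at hk'
      omega
    refine ⟨(evalAt α.1 (monicMonomial d N α.1))⁻¹ • ⟨_, hmem⟩, ?_⟩
    ext x
    rw [map_smul, Pi.smul_apply, Pi.basisFun_apply, smul_eq_mul]
    change _ * evalAt x.1 (monicMonomial d N α.1) = _
    by_cases hx : x = α
    · subst hx; simp [inv_mul_cancel₀ hne]
    · rw [Pi.single_eq_of_ne hx]
      refine mul_eq_zero_of_right _ ?_
      rw [evalAt_monicMonomial x.2]
      refine mul_eq_zero_of_right _ ?_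
      have hxs : ∑ i, x.1 i = N := mem_lattice.1 x.2
      have : ∃ i, x.1 i < α.1 i := by
        by_contra! hcon
        refine hx (Subtype.ext (funext fun i => ?_))
        have := (Finset.sum_eq_sum_iff_of_le (fun i _ => hcon i)).1 (hα.trans hxs.symm)
        exact (this i (Finset.mem_univ i)).symm
      obtain ⟨i, hi⟩ := this
      refine Finset.prod_eq_zero (Finset.mem_univ i) ?_
      rw [poch, ascPochhammer_eval_eq_zero_iff]
      exact ⟨x.1 i, hi, by simp⟩
  have hle : Module.finrank ℝ (polySpace d N) ≤ Module.finrank ℝ (lattice d N → ℝ) := by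
    rw [Module.finrank_fintype_fun_eq_card, ← Nat.card_eq_fintype_card]
    let b := basisRestrictSupport ℝ {n : Fin d →₀ ℕ | (n.sum fun _ e => e) ≤ N}
    have hb : Module.finrank ℝ (polySpace d N) =
        Nat.card {n : Fin d →₀ ℕ | (n.sum fun _ e => e) ≤ N} := Module.finrank_eq_nat_card_basis b
    rw [hb]
    have hs : ∀ n : Fin d →₀ ℕ, (n.sum fun _ e => e) = ∑ i, n i := fun n =>
      Finsupp.sum_fintype _ _ fun _ => rfl
    refine Nat.card_le_card_of_injective
      (fun s => ⟨Fin.snoc (α := fun _ => ℕ) s.1 (N - ∑ i, s.1 i), ?_⟩) ?_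
    · have h2 : (s.1.sum fun _ e => e) ≤ N := s.2
      rw [hs] at h2
      rw [mem_lattice, Fin.sum_univ_castSucc]
      simp; omega
    · intro s t hst
      refine Subtype.ext (Finsupp.ext fun i => ?_)
      have := congrFun (congrArg Subtype.val hst) i.castSucc
      simpa using this
  have hinj : Function.Injective ev := by
    have heq := le_antisymm hle (LinearMap.finrank_le_finrank_of_surjective hsurj)
    exact (LinearMap.injective_iff_surjective_of_finrank_eq_finrank heq).2 hsurj
  have : (⟨f, hf⟩ : polySpace d N) = 0 := by
    apply hinj
    rw [map_zero]
    ext x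
    exact h x.1 x.2
  exact congrArg Subtype.val this

theorem inner_self_nonneg {d : ℕ} {κ : Fin (d + 1) → ℝ} (hκ : ∀ i, -1 < κ i) (N : ℕ)
    (f : MvPolynomial (Fin d) ℝ) : 0 ≤ inner κ N f f :=
  mul_nonneg (div_nonneg (by positivity) (ascPochhammer_pos _ _ (lam_pos hκ)).le)
    (Finset.sum_nonneg fun x _ => mul_nonneg (mul_self_nonneg _) (weight_pos hκ x).le)

/-- `⟨·, ·⟩` is positive definite on `Π_N^d`. -/
theorem eq_zero_of_inner_self {d N : ℕ} {κ : Fin (d + 1) → ℝ} (hκ : ∀ i, -1 < κ i)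
    {f : MvPolynomial (Fin d) ℝ} (hf : f ∈ polySpace d N) (h : inner κ N f f = 0) : f = 0 := by
  refine eq_zero_of_evalAt hf fun x hx => ?_
  have hc : (N.factorial : ℝ) / poch (lam κ) N ≠ 0 :=
    (div_pos (by positivity) (ascPochhammer_pos _ _ (lam_pos hκ))).ne'
  have h0 := (mul_eq_zero.1 h).resolve_left hc
  rw [Finset.sum_eq_zero_iff_of_nonneg fun x _ =>
    mul_nonneg (mul_self_nonneg _) (weight_pos hκ x).le] at h0
  exact mul_self_eq_zero.1 ((mul_eq_zero.1 (h0 x hx)).resolve_right (weight_pos hκ x).ne')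

theorem polySpace_mono {d n N : ℕ} (h : n ≤ N) : polySpace d n ≤ polySpace d N := fun p hp => by
  rw [mem_restrictTotalDegree] at hp ⊢
  exact hp.trans h

theorem exists_isProj {d N n : ℕ} {κ : Fin (d + 1) → ℝ} (hκ : ∀ i, -1 < κ i) (hn : n ≤ N)
    (p : MvPolynomial (Fin d) ℝ) : ∃ q, IsProj κ N n p q := by
  have hle : orthSpace κ N n ≤ polySpace d n := fun p hp => hp.1
  have hfin : FiniteDimensional ℝ (orthSpace κ N n) :=
    Submodule.finiteDimensional_of_le hle
  have hnd : ((innerForm κ N).restrict (orthSpace κ N n)).Nondegenerate := by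
    have key : ∀ f : orthSpace κ N n, (innerForm κ N) f f = 0 → f = 0 := fun f hf =>
      Subtype.ext (eq_zero_of_inner_self hκ (polySpace_mono hn (hle f.2)) hf)
    exact ⟨fun f hf => key f (hf f), fun f hf => key f (hf f)⟩
  let q := (LinearMap.BilinForm.toDual _ hnd).symm (innerForm κ N p ∘ₗ (orthSpace κ N n).subtype)
  refine ⟨q, q.2, fun r hr => ?_⟩
  have h : inner κ N q r = inner κ N p r :=
    LinearMap.BilinForm.apply_toDual_symm_apply (hB := hnd)
      (innerForm κ N p ∘ₗ (orthSpace κ N n).subtype) ⟨r, hr⟩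
  rw [sub_eq_add_neg, ← neg_one_smul ℝ, inner_add_left, inner_smul_left, h]
  ring

theorem isProj_proj {d N n : ℕ} {κ : Fin (d + 1) → ℝ} (hκ : ∀ i, -1 < κ i) (hn : n ≤ N)
    (p : MvPolynomial (Fin d) ℝ) : IsProj κ N n p (proj κ N n p) := by
  have h := exists_isProj hκ hn p
  rw [proj, dif_pos h]
  exact h.choose_spec

theorem IsProj.eq_proj {d N n : ℕ} {κ : Fin (d + 1) → ℝ} (hκ : ∀ i, -1 < κ i) (hn : n ≤ N)
    {p q : MvPolynomial (Fin d) ℝ} (h : IsProj κ N n p q) : q = proj κ N n p := by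
  have h' := isProj_proj hκ hn p
  have hmem := Submodule.sub_mem _ h.1 h'.1
  have e1 : q - proj κ N n p = (p - proj κ N n p) + (-1 : ℝ) • (p - q) := by
    rw [neg_one_smul]; abel
  have e2 : ∀ r ∈ orthSpace κ N n, inner κ N (q - proj κ N n p) r = 0 := fun r hr => by
    rw [e1, inner_add_left, inner_smul_left, h.2 _ hr, h'.2 _ hr]
    ring
  have e := e2 _ hmem
  exact sub_eq_zero.1 (eq_zero_of_inner_self hκ (polySpace_mono hn hmem.1) e)

end HahnFrame

namespace HahnFrame

/-! ### Vandermonde convolutions over the lattice -/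

/-! Fix `n ≤ m ≤ N`, `n ≥ 1`. Everything rests on one fact: the self-adjoint operator `frameOp`, S f
= ∑_{|α|=m} H_κ(α) (κ+1)_α⁻² ⟨f, m_α⟩ m_α, acts on V_n^d as a positive scalar, and that scalar is 1
/ D_n(m, N).

On lattice values S factors as `avg` (N-lattice to m-lattice) followed by `sampling` (back again).
Vandermonde convolution shows that `avg` scales products of rising factorials (κ_i+1+x_i)_{β_i}
(`avg_rising`) and that `sampling` scales products of falling factorials (`sampling_falling`), each
by a factor depending only on |β|. Both families have leading monomials x^β, so each map is scalar
in every degree modulo lower degree (`exists_lower_order`), and hence so is S (`frameOp_eq`).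
Self-adjointness removes the lower-order remainder on V_n^d (`frameOp_eq_smul`).

Pairing with f ∈ V_n^d does not distinguish m_α from its projection, so the `hahnQ` sum is the
compression of S to V_n^d and reproduces f after multiplication by D_n (`sum_hahnQ`). Orthogonal
decomposition of Π_N^d into the V_n^d gives the expansion; pairing it with f gives the Parseval
identity. -/

theorem sum_lattice_prod_coeff {d : ℕ} {R : Type*} [CommRing R]
    (φ : Fin (d + 1) → PowerSeries R) (M : ℕ) :
    ∑ y ∈ lattice d M, ∏ i, PowerSeries.coeff (y i) (φ i) =
      PowerSeries.coeff M (∏ i, φ i) := by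
  classical
  rw [PowerSeries.coeff_prod]
  refine Finset.sum_bij' (fun y _ => Finsupp.equivFunOnFinite.symm y) (fun y _ => ⇑y) ?_ ?_ ?_ ?_ ?_
  · intro y hy
    simpa [Finset.mem_finsuppAntidiag, mem_lattice] using hy
  · intro y hy
    rw [mem_lattice]
    exact (Finset.mem_finsuppAntidiag.1 hy).1
  · intro y _
    rfl
  · intro y _
    ext; rfl
  · intro y _
    rfl

theorem prod_binomialSeries {ι : Type*} (s : Finset ι) (r : ι → ℝ) :
    ∏ i ∈ s, PowerSeries.binomialSeries ℝ (r i) = PowerSeries.binomialSeries ℝ (∑ i ∈ s, r i) := by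
  classical
  induction s using Finset.induction_on with
  | empty => simp
  | insert a s ha ih =>
    rw [Finset.prod_insert ha, Finset.sum_insert ha, ih, PowerSeries.binomialSeries_add]

/-- Compare coefficients in ∏ (1+X)^{r_i} = (1+X)^{∑ r_i}. Real exponents let one identity serve
both uses: natural r for `sampling`, negative r (Pochhammer symbols) for `avg`. -/
theorem sum_lattice_prod_ringChoose {d : ℕ} (r : Fin (d + 1) → ℝ) (M : ℕ) :
    ∑ y ∈ lattice d M, ∏ i, Ring.choose (r i) (y i) = Ring.choose (∑ i, r i) M := by
  have h := sum_lattice_prod_coeff (fun i => PowerSeries.binomialSeries ℝ (r i)) M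
  rw [prod_binomialSeries] at h
  simpa [PowerSeries.binomialSeries_coeff] using h

theorem sum_lattice_prod_choose {d : ℕ} (x : Fin (d + 1) → ℕ) (M : ℕ) :
    ∑ y ∈ lattice d M, ∏ i, (x i).choose (y i) = (∑ i, x i).choose M := by
  have h := sum_lattice_prod_ringChoose (fun i => (x i : ℝ)) M
  simp_rw [← Nat.cast_sum, Ring.choose_natCast] at h
  exact_mod_cast h

theorem ringChoose_neg (a : ℝ) (k : ℕ) :
    Ring.choose (-a) k = (-1) ^ k * (poch a k / k.factorial) := by
  rw [Ring.choose_eq_smul, Polynomial.descPochhammer_smeval_eq_ascPochhammer,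
    Polynomial.ascPochhammer_smeval_eq_eval, ← descPochhammer_eval_eq_ascPochhammer,
    poch, ← neg_neg a, ascPochhammer_eval_neg_eq_descPochhammer, neg_neg, smul_eq_mul]
  have h : ((-1 : ℝ) ^ k) * (-1) ^ k = 1 := by rw [← mul_pow]; simp
  field_simp
  linear_combination (-(Polynomial.eval (-a) (descPochhammer ℝ k))) * h

theorem sum_lattice_prod_poch {d : ℕ} (a : Fin (d + 1) → ℝ) (M : ℕ) :
    ∑ y ∈ lattice d M, ∏ i, (poch (a i) (y i) / ((y i).factorial : ℝ)) =
      poch (∑ i, a i) M / M.factorial := by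
  have h := sum_lattice_prod_ringChoose (fun i => -a i) M
  simp_rw [Finset.sum_neg_distrib, ringChoose_neg, Finset.prod_mul_distrib,
    Finset.prod_pow_eq_pow_sum] at h
  rw [Finset.sum_congr rfl fun y hy => by rw [mem_lattice.1 hy], ← Finset.mul_sum] at h
  exact mul_left_cancel₀ (by simp) h

theorem sum_lattice_eq_sum_add {d M k : ℕ} (hk : k ≤ M) {β : Fin (d + 1) → ℕ}
    (hβ : ∑ i, β i = k) (F : (Fin (d + 1) → ℕ) → ℝ) (hF : ∀ x, ¬ β ≤ x → F x = 0) :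
    ∑ x ∈ lattice d M, F x = ∑ y ∈ lattice d (M - k), F (β + y) := by
  symm
  refine Finset.sum_of_injOn (fun y => β + y) (fun _ _ _ _ h => add_left_cancel h) ?_ ?_ ?_
  · intro y hy
    rw [Finset.mem_coe, mem_lattice] at hy ⊢
    simp only [Pi.add_apply, Finset.sum_add_distrib, hβ, hy]
    omega
  · intro x hx hx'
    refine hF x fun hle => hx' ⟨x - β, ?_, add_tsub_cancel_of_le hle⟩
    rw [Finset.mem_coe, mem_lattice]
    rw [mem_lattice] at hx
    have : ∑ i, (β i + (x - β) i) = M := by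
      rw [← hx]
      exact Finset.sum_congr rfl fun i _ => Nat.add_sub_of_le (hle i)
    rw [Finset.sum_add_distrib, hβ] at this
    omega
  · intro y _
    rfl

/-! ### Pochhammer symbols -/

theorem poch_pos {a : ℝ} (ha : 0 < a) (n : ℕ) : 0 < poch a n := ascPochhammer_pos _ _ ha

theorem poch_add (a : ℝ) (m n : ℕ) : poch a (m + n) = poch a m * poch (a + m) n := by
  have h := congrArg (Polynomial.eval a) (ascPochhammer_mul ℝ m n)
  simp only [Polynomial.eval_mul, Polynomial.eval_comp, Polynomial.eval_add, Polynomial.eval_X,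
    Polynomial.eval_natCast] at h
  exact h.symm

theorem poch_zero (a : ℝ) : poch a 0 = 1 := by simp [poch]

theorem poch_eq_prod_range (a : ℝ) (n : ℕ) : poch a n = ∏ j ∈ Finset.range n, (a + j) := by
  induction n with
  | zero => simp [poch]
  | succ n ih =>
    rw [Finset.prod_range_succ, ← ih, poch, poch, ascPochhammer_succ_eval]

theorem poch_neg_natCast (n k : ℕ) : poch (-(n : ℝ)) k = (-1) ^ k * (n.descFactorial k : ℝ) := by
  rw [poch, ascPochhammer_eval_neg_eq_descPochhammer, descPochhammer_eval_eq_descFactorial]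

theorem poch_neg_natCast_of_le {n k : ℕ} (h : k ≤ n) :
    poch (-(n : ℝ)) k = (-1) ^ k * (n.factorial / (n - k).factorial) := by
  rw [poch_neg_natCast, ← Nat.factorial_mul_descFactorial h]
  push_cast
  field_simp

/-! ### Values of m_α on the lattice and normalization of the weight. -/

theorem evalAt_monicMonomial_eq {d N : ℕ} {x : Fin (d + 1) → ℕ} (hx : x ∈ lattice d N)
    (α : Fin (d + 1) → ℕ) :
    evalAt x (monicMonomial d N α) = ∏ i, ((x i).descFactorial (α i) : ℝ) := by
  rw [evalAt_monicMonomial hx]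
  simp_rw [poch_neg_natCast, Finset.prod_mul_distrib, Finset.prod_pow_eq_pow_sum]
  rw [← mul_assoc, ← mul_pow]
  simp

theorem sum_weight {d : ℕ} (κ : Fin (d + 1) → ℝ) (N : ℕ) :
    ∑ x ∈ lattice d N, weight κ x = poch (lam κ) N / N.factorial := by
  have h := sum_lattice_prod_poch (fun i => κ i + 1) N
  simp_rw [Finset.prod_div_distrib] at h
  simp only [weight, h, lam]
  congr 2
  simp [Finset.sum_add_distrib]
  ring

theorem inner_one_one {d : ℕ} {κ : Fin (d + 1) → ℝ} (hκ : ∀ i, -1 < κ i) (N : ℕ) :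
    inner κ N (1 : MvPolynomial (Fin d) ℝ) 1 = 1 := by
  have h : 0 < poch (lam κ) N := poch_pos (lam_pos hκ) N
  simp only [inner, evalAt, map_one, one_mul, sum_weight]
  field_simp

/-! ### Averaging and sampling on factorial bases. -/

/-- The averaging operator `f ↦ (α ↦ ⟨f, m_α⟩ / (κ + 1)_α)`. -/
noncomputable def avg {d : ℕ} (κ : Fin (d + 1) → ℝ) (N m : ℕ) :
    MvPolynomial (Fin d) ℝ →ₗ[ℝ] (lattice d m → ℝ) where
  toFun f α := (∏ i, poch (κ i + 1) (α.1 i))⁻¹ * inner κ N f (monicMonomial d N α.1)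
  map_add' f g := by ext α; simp [inner_add_left, mul_add]
  map_smul' c f := by ext α; simp [inner_smul_left]; ring

/-- The hypergeometric sampling operator `g ↦ (x ↦ ∑_{|α| = m} g(α) m_α(x) / α!)`. -/
noncomputable def sampling (d N m : ℕ) :
    MvPolynomial (Fin d) ℝ →ₗ[ℝ] (lattice d N → ℝ) where
  toFun g x := ∑ α ∈ lattice d m, evalAt α g * ∏ i, ((x.1 i).choose (α i) : ℝ)
  map_add' f g := by ext α; simp [evalAt, add_mul, Finset.sum_add_distrib]
  map_smul' c f := by ext α; simp [evalAt, smul_eval, Finset.mul_sum, mul_assoc]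

/-- Evaluation on the lattice. -/
noncomputable def evalLattice (d N : ℕ) :
    MvPolynomial (Fin d) ℝ →ₗ[ℝ] (lattice d N → ℝ) where
  toFun g x := evalAt x.1 g
  map_add' f g := by ext α; simp [evalAt]
  map_smul' c f := by ext α; simp [evalAt, smul_eval]

/-- The products `∏ᵢ ∏_{j < βᵢ} (Xᵢ + c i j)`. -/
noncomputable def shiftedMonomial {d : ℕ} (c : Fin d → ℕ → ℝ) (β : Fin d →₀ ℕ) :
    MvPolynomial (Fin d) ℝ :=
  ∏ i, ∏ j ∈ Finset.range (β i), (X i + C (c i j))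

/-- A multi-index in `d` variables, extended by zero in the last coordinate. -/
def extendZero {d : ℕ} (β : Fin d →₀ ℕ) : Fin (d + 1) → ℕ := Fin.snoc (α := fun _ => ℕ) β 0

theorem sum_extendZero {d : ℕ} (β : Fin d →₀ ℕ) : ∑ i, extendZero β i = β.degree := by
  rw [Fin.sum_univ_castSucc]
  simp [extendZero, Finsupp.degree_eq_sum]

theorem evalAt_shiftedMonomial_rising {d : ℕ} (κ : Fin (d + 1) → ℝ) (β : Fin d →₀ ℕ)
    (x : Fin (d + 1) → ℕ) :
    evalAt x (shiftedMonomial (fun i j => κ i.castSucc + 1 + j) β) =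
      ∏ i, poch (κ i + 1 + x i) (extendZero β i) := by
  rw [Fin.prod_univ_castSucc]
  simp only [evalAt, shiftedMonomial, map_prod, map_add, eval_X, eval_C, extendZero,
    Fin.snoc_castSucc, Fin.snoc_last]
  rw [poch_zero, mul_one]
  refine Finset.prod_congr rfl fun i _ => ?_
  rw [poch_eq_prod_range]
  exact Finset.prod_congr rfl fun j _ => by ring

theorem evalAt_shiftedMonomial_falling {d : ℕ} (β : Fin d →₀ ℕ) (x : Fin (d + 1) → ℕ) :
    evalAt x (shiftedMonomial (fun _ j => -(j : ℝ)) β) =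
      ∏ i, ((x i).descFactorial (extendZero β i) : ℝ) := by
  rw [Fin.prod_univ_castSucc]
  simp only [evalAt, shiftedMonomial, map_prod, map_add, eval_X, eval_C, extendZero,
    Fin.snoc_castSucc, Fin.snoc_last]
  simp only [Nat.descFactorial_zero, Nat.cast_one, mul_one]
  refine Finset.prod_congr rfl fun i _ => ?_
  rw [← descPochhammer_eval_eq_descFactorial ℝ, descPochhammer_eval_eq_prod_range]
  exact Finset.prod_congr rfl fun j _ => by ring

/-- The factor by which `avg` scales polynomials of degree `k`, up to lower degree. -/
noncomputable def avgFactor {d : ℕ} (κ : Fin (d + 1) → ℝ) (N m k : ℕ) : ℝ :=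
  N.factorial / poch (lam κ) N * (poch (lam κ + m + k) (N - m) / (N - m).factorial)

/-- The factor m_α restricts the sum to x = α + y. There the weight contributes (κ+1)_α (κ+1+α)_y
and b contributes (κ+1+α+y)_β. Since (κ+1+α)_y (κ+1+α+y)_β = (κ+1+α)_β (κ+1+α+β)_y, the value b(α)
splits off and the remaining sum over y is a Vandermonde convolution depending on β only through
|β|. -/
theorem avg_rising {d N m : ℕ} {κ : Fin (d + 1) → ℝ} (hκ : ∀ i, -1 < κ i) (hm : m ≤ N)
    (β : Fin d →₀ ℕ) :
    avg κ N m (shiftedMonomial (fun i j => κ i.castSucc + 1 + j) β) =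
      avgFactor κ N m β.degree •
        evalLattice d m (shiftedMonomial (fun i j => κ i.castSucc + 1 + j) β) := by
  ext ⟨α, hα⟩
  have hαs := mem_lattice.1 hα
  set b := shiftedMonomial (fun (i : Fin d) j => κ i.castSucc + 1 + (j : ℝ)) β with hb
  change (∏ i, poch (κ i + 1) (α i))⁻¹ * inner κ N b (monicMonomial d N α) =
    avgFactor κ N m β.degree * evalAt α b
  have hpos : 0 < ∏ i, poch (κ i + 1) (α i) :=
    Finset.prod_pos fun i _ => poch_pos (by linarith [hκ i]) _
  have h1 : ∑ x ∈ lattice d N, evalAt x b * evalAt x (monicMonomial d N α) * weight κ x =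
      ∑ x ∈ lattice d N, evalAt x b * (∏ i, ((x i).descFactorial (α i) : ℝ)) * weight κ x :=
    Finset.sum_congr rfl fun x hx => by rw [evalAt_monicMonomial_eq hx]
  have h2 := sum_lattice_eq_sum_add hm hαs
    (fun x => evalAt x b * (∏ i, ((x i).descFactorial (α i) : ℝ)) * weight κ x) (by
      intro x hx
      simp only [Pi.le_def, not_forall, not_le] at hx
      obtain ⟨i, hi⟩ := hx
      have : ∏ i, ((x i).descFactorial (α i) : ℝ) = 0 :=
        Finset.prod_eq_zero (Finset.mem_univ i) (by
          exact_mod_cast Nat.descFactorial_eq_zero_iff_lt.2 hi)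
      simp [this])
  have h3 : ∀ y : Fin (d + 1) → ℕ,
      evalAt (α + y) b * (∏ i, (((α + y) i).descFactorial (α i) : ℝ)) * weight κ (α + y) =
      (∏ i, poch (κ i + 1) (α i)) * evalAt α b *
        ∏ i, (poch (κ i + 1 + α i + extendZero β i) (y i) / ((y i).factorial : ℝ)) := by
    intro y
    rw [hb, evalAt_shiftedMonomial_rising, evalAt_shiftedMonomial_rising, weight]
    simp only [← Finset.prod_mul_distrib, ← Finset.prod_div_distrib]
    refine Finset.prod_congr rfl fun i _ => ?_
    simp only [Pi.add_apply]
    have e1 := poch_add (κ i + 1) (α i) (y i)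
    have e2 := poch_add (κ i + 1 + α i) (y i) (extendZero β i)
    have e3 := poch_add (κ i + 1 + α i) (extendZero β i) (y i)
    -- The two splittings of (κ_i+1+α_i)_{y_i+β_i} are equated.
    rw [add_comm (y i), e3] at e2
    have e4 : (((α i + y i).factorial : ℕ) : ℝ) =
        (y i).factorial * (α i + y i).descFactorial (α i) := by
      have := Nat.factorial_mul_descFactorial (Nat.le_add_right (α i) (y i))
      rw [Nat.add_sub_cancel_left] at this
      exact_mod_cast this.symm
    have e5 : ((α i + y i).descFactorial (α i) : ℝ) ≠ 0 := by
      rw [Nat.cast_ne_zero, Ne, Nat.descFactorial_eq_zero_iff_lt]; omega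
    rw [e1, e4]
    push_cast
    rw [← add_assoc]
    field_simp
    linear_combination (-poch (κ i + 1) (α i)) * e2
  rw [inner, h1, h2, Finset.sum_congr rfl fun y _ => h3 y, ← Finset.mul_sum,
    sum_lattice_prod_poch]
  have h4 : ∑ i, (κ i + 1 + (α i : ℝ) + extendZero β i) = lam κ + m + β.degree := by
    simp only [Finset.sum_add_distrib, ← Nat.cast_sum, hαs, sum_extendZero, lam]
    simp
    ring
  rw [h4, avgFactor]
  field_simp

/-- Trinomial revision C(x,α) C(α,β) = C(x,β) C(x−β, α−β) in each coordinate pulls out the falling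
product at x; Vandermonde sums the rest over α − β. -/
theorem sampling_falling {d N m : ℕ} (β : Fin d →₀ ℕ) (hβ : β.degree ≤ m) :
    sampling d N m (shiftedMonomial (fun _ j => -(j : ℝ)) β) =
      ((N - β.degree).choose (m - β.degree) : ℝ) •
        evalLattice d N (shiftedMonomial (fun _ j => -(j : ℝ)) β) := by
  ext ⟨x, hx⟩
  change ∑ α ∈ lattice d m, evalAt α _ * ∏ i, ((x i).choose (α i) : ℝ) =
    ((N - β.degree).choose (m - β.degree) : ℝ) * evalAt x _
  simp only [evalAt_shiftedMonomial_falling]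
  rw [sum_lattice_eq_sum_add hβ (sum_extendZero β)]
  · have h : ∀ y : Fin (d + 1) → ℕ,
        (∏ i, (((extendZero β + y) i).descFactorial (extendZero β i) : ℝ)) *
          ∏ i, ((x i).choose ((extendZero β + y) i) : ℝ) =
        (∏ i, ((x i).descFactorial (extendZero β i) : ℝ)) *
          ∏ i, ((x i - extendZero β i).choose (y i) : ℝ) := by
      intro y
      simp only [← Finset.prod_mul_distrib]
      refine Finset.prod_congr rfl fun i _ => ?_
      simp only [Pi.add_apply]
      have := Nat.choose_mul (n := x i) (Nat.le_add_right (extendZero β i) (y i))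
      rw [Nat.add_sub_cancel_left] at this
      rw [Nat.descFactorial_eq_factorial_mul_choose, Nat.descFactorial_eq_factorial_mul_choose]
      norm_cast
      rw [mul_assoc, mul_assoc, ← this, mul_comm (Nat.choose (x i) _)]
    rw [Finset.sum_congr rfl fun y _ => h y, ← Finset.mul_sum]
    -- If β ≰ x, truncated subtraction spoils ∑ (x_i − β_i) = N − |β|, but the falling product at x
    -- is zero and both sides vanish.
    by_cases hle : extendZero β ≤ x
    · have h5 := sum_lattice_prod_choose (fun i => x i - extendZero β i) (m - β.degree)
      have h6 : ∑ i, (x i - extendZero β i) = N - β.degree := by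
        rw [← mem_lattice.1 hx, ← sum_extendZero β]
        exact Finset.sum_tsub_distrib _ fun i _ => hle i
      rw [h6] at h5
      rw [← h5]
      push_cast
      ring
    · simp only [Pi.le_def, not_forall, not_le] at hle
      obtain ⟨i, hi⟩ := hle
      have : ∏ i, ((x i).descFactorial (extendZero β i) : ℝ) = 0 :=
        Finset.prod_eq_zero (Finset.mem_univ i) (by
          exact_mod_cast Nat.descFactorial_eq_zero_iff_lt.2 hi)
      simp [this]
  · intro α hα
    simp only [Pi.le_def, not_forall, not_le] at hα
    obtain ⟨i, hi⟩ := hα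
    refine mul_eq_zero_of_left (Finset.prod_eq_zero (Finset.mem_univ i) ?_) _
    exact_mod_cast Nat.descFactorial_eq_zero_iff_lt.2 hi

/-! ### Polynomials of degree less than `k` -/

/-- Polynomials all of whose monomials have degree less than `k`. -/
noncomputable def lowSpace (d k : ℕ) : Submodule ℝ (MvPolynomial (Fin d) ℝ) :=
  restrictSupport ℝ {β | β.degree < k}

theorem lowSpace_succ (d k : ℕ) : lowSpace d (k + 1) = polySpace d k := by
  rw [lowSpace, polySpace, restrictTotalDegree]
  congr 1
  ext β
  simp [Finsupp.degree_apply, Finsupp.sum]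

/-- The strict bound makes degree 0 the base case with no remainder, so the triangularity arguments
need no separate treatment of constants. -/
theorem lowSpace_zero (d : ℕ) : lowSpace d 0 = ⊥ := by
  rw [eq_bot_iff]
  intro p hp
  rw [lowSpace, mem_restrictSupport_iff] at hp
  simpa using hp

theorem lowSpace_mono {d a b : ℕ} (h : a ≤ b) : lowSpace d a ≤ lowSpace d b :=
  restrictSupport_mono ℝ fun _ hβ => lt_of_lt_of_le hβ h

/-- Positivity of k is needed because the zero polynomial has `totalDegree` 0. -/
theorem totalDegree_lt_of_mem_lowSpace {d k : ℕ} (hk : 0 < k) {p : MvPolynomial (Fin d) ℝ}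
    (hp : p ∈ lowSpace d k) : p.totalDegree < k := by
  obtain ⟨j, rfl⟩ := Nat.exists_eq_succ_of_ne_zero hk.ne'
  rw [Nat.succ_eq_add_one, lowSpace_succ, mem_restrictTotalDegree] at hp
  omega

open scoped Pointwise in
theorem mul_mem_lowSpace {d a b : ℕ} {p q : MvPolynomial (Fin d) ℝ}
    (hp : p ∈ lowSpace d a) (hq : q ∈ lowSpace d (b + 1)) : p * q ∈ lowSpace d (a + b) := by
  have h : p * q ∈ restrictSupport ℝ
      ({β : Fin d →₀ ℕ | β.degree < a} + {β : Fin d →₀ ℕ | β.degree < b + 1}) := by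
    rw [restrictSupport_add]
    exact Submodule.mul_mem_mul hp hq
  refine restrictSupport_mono ℝ ?_ h
  rintro _ ⟨β, hβ, γ, hγ, rfl⟩
  simp only [Set.mem_ofPred_eq, map_add] at hβ hγ ⊢
  omega

theorem monomial_mem_lowSpace {d k : ℕ} {β : Fin d →₀ ℕ} (hβ : β.degree < k) (c : ℝ) :
    monomial β c ∈ lowSpace d k :=
  (monomial_mem_restrictSupport ℝ).2 (Or.inl hβ)

/-- `p` is the monomial `X ^ β` up to terms of lower degree. -/
def HasLead {d : ℕ} (p : MvPolynomial (Fin d) ℝ) (β : Fin d →₀ ℕ) : Prop :=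
  p - monomial β 1 ∈ lowSpace d β.degree

theorem HasLead.mem {d : ℕ} {p : MvPolynomial (Fin d) ℝ} {β : Fin d →₀ ℕ} (h : HasLead p β) :
    p ∈ lowSpace d (β.degree + 1) := by
  rw [← sub_add_cancel p (monomial β 1)]
  exact Submodule.add_mem _ (lowSpace_mono (Nat.le_succ _) h)
    (monomial_mem_lowSpace (Nat.lt_succ_self _) 1)

theorem HasLead.mul {d : ℕ} {p q : MvPolynomial (Fin d) ℝ} {β γ : Fin d →₀ ℕ}
    (hp : HasLead p β) (hq : HasLead q γ) : HasLead (p * q) (β + γ) := by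
  have h : p * q - monomial (β + γ) 1 =
      (p - monomial β 1) * q + (q - monomial γ 1) * monomial β 1 := by
    have : (monomial (β + γ) 1 : MvPolynomial (Fin d) ℝ) = monomial β 1 * monomial γ 1 := by
      simp [monomial_mul]
    rw [this]; ring
  rw [HasLead, h, map_add]
  refine Submodule.add_mem _ (mul_mem_lowSpace hp hq.mem) ?_
  rw [add_comm]
  exact mul_mem_lowSpace hq (monomial_mem_lowSpace (Nat.lt_succ_self _) 1)

theorem HasLead.prod {d : ℕ} {ι : Type*} (s : Finset ι) {p : ι → MvPolynomial (Fin d) ℝ}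
    {β : ι → Fin d →₀ ℕ} (h : ∀ i ∈ s, HasLead (p i) (β i)) :
    HasLead (∏ i ∈ s, p i) (∑ i ∈ s, β i) := by
  classical
  induction s using Finset.induction_on with
  | empty => simp [HasLead]
  | insert a s ha ih =>
    rw [Finset.prod_insert ha, Finset.sum_insert ha]
    exact (h a (Finset.mem_insert_self a s)).mul
      (ih fun i hi => h i (Finset.mem_insert_of_mem hi))

theorem hasLead_X_add_C {d : ℕ} (i : Fin d) (c : ℝ) :
    HasLead (X i + C c) (Finsupp.single i 1) := by
  have h : (X i + C c : MvPolynomial (Fin d) ℝ) - monomial (Finsupp.single i 1) 1 =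
      monomial 0 c := by
    rw [X, C_apply]; ring
  rw [HasLead, h]
  exact monomial_mem_lowSpace (by simp) c

/-- A linear map which scales a family of polynomials with leading monomials `X ^ β` by factors
depending only on `|β|` scales every polynomial of degree `k`, up to terms of lower degree. -/
theorem exists_lower_order {d K : ℕ} {E : Type*} [AddCommGroup E] [Module ℝ E]
    {T ev : MvPolynomial (Fin d) ℝ →ₗ[ℝ] E} {b : (Fin d →₀ ℕ) → MvPolynomial (Fin d) ℝ}
    (hb : ∀ β, HasLead (b β) β) {t : ℕ → ℝ}
    (hT : ∀ β, β.degree ≤ K → T (b β) = t β.degree • ev (b β)) (k : ℕ) (hk : k ≤ K)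
    (f : MvPolynomial (Fin d) ℝ) (hf : f ∈ lowSpace d (k + 1)) :
    ∃ r ∈ lowSpace d k, T f = t k • ev f + ev r := by
  induction k using Nat.strong_induction_on generalizing f with
  | _ k ih =>
  -- The induction hypothesis in weak form: below degree k, `T` yields values of polynomials that
  -- are again below degree k.
  have hlow : ∀ s ∈ lowSpace d k, ∃ h ∈ lowSpace d k, T s = ev h := by
    intro s hs
    rcases k with _ | j
    · rw [lowSpace_zero, Submodule.mem_bot] at hs
      exact ⟨0, Submodule.zero_mem _, by rw [hs, map_zero, map_zero]⟩
    · obtain ⟨r, hr, h⟩ := ih j (Nat.lt_succ_self j) (by omega) s hs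
      refine ⟨t j • s + r, Submodule.add_mem _ (Submodule.smul_mem _ _ hs)
        (lowSpace_mono (Nat.le_succ j) hr), ?_⟩
      rw [h, map_add, map_smul]
  rw [lowSpace, restrictSupport_eq_span] at hf
  induction hf using Submodule.span_induction with
  | mem _ hx =>
    obtain ⟨β, hβ, rfl⟩ := hx
    rcases Nat.lt_succ_iff_lt_or_eq.1 hβ with hlt | rfl
    · have hmem := monomial_mem_lowSpace hlt 1
      obtain ⟨h, hh, e⟩ := hlow _ hmem
      refine ⟨h - t k • monomial β 1, Submodule.sub_mem _ hh (Submodule.smul_mem _ _ hmem), ?_⟩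
      rw [map_sub, map_smul, e]
      abel
    · obtain ⟨h, hh, e⟩ := hlow _ (hb β)
      refine ⟨t β.degree • (b β - monomial β 1) - h,
        Submodule.sub_mem _ (Submodule.smul_mem _ _ (hb β)) hh, ?_⟩
      have e' : T (monomial β 1) = T (b β) - T (b β - monomial β 1) := by
        rw [map_sub]; abel
      dsimp only
      rw [e', e, hT β hk, map_sub, map_smul, map_sub, smul_sub]
      abel
  | zero => exact ⟨0, Submodule.zero_mem _, by simp⟩
  | add f g _ _ hf hg =>
    obtain ⟨r, hr, e⟩ := hf
    obtain ⟨s, hs, e'⟩ := hg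
    refine ⟨r + s, Submodule.add_mem _ hr hs, ?_⟩
    rw [map_add, e, e', map_add, map_add, smul_add]
    abel
  | smul c f _ hf =>
    obtain ⟨r, hr, e⟩ := hf
    refine ⟨c • r, Submodule.smul_mem _ _ hr, ?_⟩
    rw [map_smul, e, map_smul, map_smul, smul_add, smul_comm]

/-! ### The frame operator -/

theorem hasLead_shiftedMonomial {d : ℕ} (c : Fin d → ℕ → ℝ) (β : Fin d →₀ ℕ) :
    HasLead (shiftedMonomial c β) β := by
  have h := HasLead.prod Finset.univ (p := fun i : Fin d =>
    ∏ j ∈ Finset.range (β i), (X i + C (c i j)))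
    (β := fun i => ∑ _j ∈ Finset.range (β i), Finsupp.single i 1)
    fun i _ => HasLead.prod _ fun j _ => hasLead_X_add_C i (c i j)
  have e : ∑ i : Fin d, ∑ _j ∈ Finset.range (β i), Finsupp.single i 1 = β := by
    ext k
    simp
  rwa [e] at h

/-- The operator `f ↦ ∑_{|α| = m} H_κ(α) (κ + 1)_α⁻² ⟨f, m_α⟩ m_α`. -/
noncomputable def frameOp {d : ℕ} (κ : Fin (d + 1) → ℝ) (N m : ℕ) (f : MvPolynomial (Fin d) ℝ) :
    MvPolynomial (Fin d) ℝ :=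
  ∑ α ∈ lattice d m, (weight κ α * ((∏ i, poch (κ i + 1) (α i))⁻¹ *
    ((∏ i, poch (κ i + 1) (α i))⁻¹ * inner κ N f (monicMonomial d N α)))) • monicMonomial d N α

theorem inner_sum_left {d : ℕ} {ι : Type*} (κ : Fin (d + 1) → ℝ) (N : ℕ) (s : Finset ι)
    (f : ι → MvPolynomial (Fin d) ℝ) (g : MvPolynomial (Fin d) ℝ) :
    inner κ N (∑ i ∈ s, f i) g = ∑ i ∈ s, inner κ N (f i) g := by
  change innerForm κ N _ g = _
  rw [map_sum, LinearMap.sum_apply]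
  rfl

theorem inner_sub_left {d : ℕ} (κ : Fin (d + 1) → ℝ) (N : ℕ) (f g h : MvPolynomial (Fin d) ℝ) :
    inner κ N (f - g) h = inner κ N f h - inner κ N g h := by
  rw [sub_eq_add_neg, ← neg_one_smul ℝ, inner_add_left, inner_smul_left]
  ring

/-- The right-hand side is a weighted dot product of the averages of f and g, hence symmetric;
self-adjointness follows from this. -/
theorem inner_frameOp {d : ℕ} (κ : Fin (d + 1) → ℝ) (N m : ℕ) (f g : MvPolynomial (Fin d) ℝ) :
    inner κ N (frameOp κ N m f) g =
      ∑ α ∈ lattice d m, weight κ α * (((∏ i, poch (κ i + 1) (α i))⁻¹ *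
        inner κ N f (monicMonomial d N α)) * ((∏ i, poch (κ i + 1) (α i))⁻¹ *
        inner κ N g (monicMonomial d N α))) := by
  rw [frameOp, inner_sum_left]
  refine Finset.sum_congr rfl fun α _ => ?_
  rw [inner_smul_left, inner_comm κ N _ g]
  ring

theorem inner_frameOp_comm {d : ℕ} (κ : Fin (d + 1) → ℝ) (N m : ℕ)
    (f g : MvPolynomial (Fin d) ℝ) :
    inner κ N (frameOp κ N m f) g = inner κ N f (frameOp κ N m g) := by
  rw [inner_comm κ N f, inner_frameOp, inner_frameOp]
  exact Finset.sum_congr rfl fun α _ => by ring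

theorem frameOp_mem {d N m : ℕ} (κ : Fin (d + 1) → ℝ) (hm : m ≤ N)
    (f : MvPolynomial (Fin d) ℝ) : frameOp κ N m f ∈ polySpace d N := by
  refine Submodule.sum_mem _ fun α hα => Submodule.smul_mem _ _ ?_
  have h := monicMonomial_mem (d := d) N α
  rw [mem_lattice.1 hα] at h
  exact polySpace_mono hm h

/-- One factor (κ+1)_α⁻¹ forms the average; the other cancels the numerator of H_κ(α), leaving
m_α(x)/α! = ∏ C(x_i, α_i). -/
theorem evalLattice_frameOp {d N m : ℕ} {κ : Fin (d + 1) → ℝ} (hκ : ∀ i, -1 < κ i)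
    {f h : MvPolynomial (Fin d) ℝ} (hh : avg κ N m f = evalLattice d m h) :
    evalLattice d N (frameOp κ N m f) = sampling d N m h := by
  ext ⟨x, hx⟩
  change evalAt x (frameOp κ N m f) = ∑ α ∈ lattice d m, evalAt α h * _
  simp only [frameOp, evalAt, map_sum, smul_eval]
  refine Finset.sum_congr rfl fun α hα => ?_
  have h1 : (∏ i, poch (κ i + 1) (α i))⁻¹ * inner κ N f (monicMonomial d N α) = evalAt α h :=
    congrFun hh ⟨α, hα⟩
  change _ * evalAt x (monicMonomial d N α) = evalAt α h * _
  have hpos : 0 < ∏ i, poch (κ i + 1) (α i) :=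
    Finset.prod_pos fun i _ => poch_pos (by linarith [hκ i]) _
  rw [h1, evalAt_monicMonomial_eq hx, weight]
  simp_rw [Nat.descFactorial_eq_factorial_mul_choose, Nat.cast_mul, Finset.prod_mul_distrib]
  have hf : (∏ i, ((α i).factorial : ℝ)) ≠ 0 :=
    Finset.prod_ne_zero_iff.2 fun i _ => by positivity
  field_simp

/-- The eigenvalue of `frameOp` on `V_n^d`. -/
noncomputable def frameEigenvalue {d : ℕ} (κ : Fin (d + 1) → ℝ) (N m n : ℕ) : ℝ :=
  avgFactor κ N m n * ((N - n).choose (m - n) : ℝ)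

theorem frameOp_eq {d N m k : ℕ} {κ : Fin (d + 1) → ℝ} (hκ : ∀ i, -1 < κ i) (hk : k ≤ m)
    (hm : m ≤ N) {f : MvPolynomial (Fin d) ℝ} (hf : f ∈ lowSpace d (k + 1)) :
    ∃ r ∈ lowSpace d k, frameOp κ N m f = frameEigenvalue κ N m k • f + r := by
  obtain ⟨r, hr, e⟩ := exists_lower_order (K := m)
    (hasLead_shiftedMonomial fun (i : Fin d) j => κ i.castSucc + 1 + (j : ℝ))
    (t := avgFactor κ N m) (fun β _ => avg_rising hκ hm β) k hk f hf
  have hr' := lowSpace_mono (Nat.le_succ k) hr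
  rw [← map_smul, ← map_add] at e
  obtain ⟨s, hs, e'⟩ := exists_lower_order (K := m)
    (hasLead_shiftedMonomial fun (_ : Fin d) j => -(j : ℝ))
    (t := fun k => ((N - k).choose (m - k) : ℝ)) (fun β hβ => sampling_falling (N := N) β hβ) k hk
    (avgFactor κ N m k • f + r) (Submodule.add_mem _ (Submodule.smul_mem _ _ hf) hr')
  refine ⟨((N - k).choose (m - k) : ℝ) • r + s,
    Submodule.add_mem _ (Submodule.smul_mem _ _ hr) hs, ?_⟩
  have hmem : ∀ p ∈ lowSpace d (k + 1), p ∈ polySpace d N := fun p hp => by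
    rw [lowSpace_succ] at hp
    exact polySpace_mono (hk.trans hm) hp
  have key : frameOp κ N m f - (frameEigenvalue κ N m k • f +
      (((N - k).choose (m - k) : ℝ) • r + s)) = 0 := by
    -- The factorization is known only for lattice values; since all terms have degree at most N,
    -- these values determine the polynomials.
    refine eq_zero_of_evalAt (N := N) (Submodule.sub_mem _ (frameOp_mem κ hm f)
      (Submodule.add_mem _ (Submodule.smul_mem _ _ (hmem _ hf)) (Submodule.add_mem _
        (Submodule.smul_mem _ _ (hmem _ hr'))
        (hmem _ (lowSpace_mono (Nat.le_succ k) hs))))) fun x hx => ?_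
    have h0 : evalLattice d N (frameOp κ N m f - (frameEigenvalue κ N m k • f +
      (((N - k).choose (m - k) : ℝ) • r + s))) = 0 := by
      rw [map_sub, evalLattice_frameOp hκ e, e', ← map_smul, ← map_add, ← map_sub,
        frameEigenvalue, smul_add, smul_smul, mul_comm (avgFactor κ N m k)]
      rw [add_assoc, sub_self, map_zero]
    exact congrFun h0 ⟨x, hx⟩
  exact sub_eq_zero.1 key

/-- Let e be the lower-degree remainder of S f. Since S preserves lower degree, ⟨S f, e⟩ = ⟨f, S e⟩
= 0, while also ⟨f, e⟩ = 0; thus ⟨e, e⟩ = 0. -/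
theorem frameOp_eq_smul {d N m n : ℕ} {κ : Fin (d + 1) → ℝ} (hκ : ∀ i, -1 < κ i) (hn : 0 < n)
    (hnm : n ≤ m) (hm : m ≤ N) {f : MvPolynomial (Fin d) ℝ} (hf : f ∈ orthSpace κ N n) :
    frameOp κ N m f = frameEigenvalue κ N m n • f := by
  obtain ⟨e, he, h⟩ := frameOp_eq hκ hnm hm (f := f) (by rw [lowSpace_succ]; exact hf.1)
  have hlow : ∀ p ∈ lowSpace d n, frameOp κ N m p ∈ lowSpace d n := by
    intro p hp
    obtain ⟨j, rfl⟩ := Nat.exists_eq_succ_of_ne_zero hn.ne'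
    obtain ⟨r, hr, h⟩ := frameOp_eq hκ ((Nat.le_succ j).trans hnm) hm hp
    rw [h]
    exact Submodule.add_mem _ (Submodule.smul_mem _ _ hp) (lowSpace_mono (Nat.le_succ j) hr)
  have horth : ∀ p ∈ lowSpace d n, inner κ N f p = 0 := fun p hp =>
    hf.2 p (totalDegree_lt_of_mem_lowSpace hn hp)
  have heN : e ∈ polySpace d N := by
    have := lowSpace_mono (Nat.le_succ n) he
    rw [Nat.succ_eq_add_one, lowSpace_succ] at this
    exact polySpace_mono (hnm.trans hm) this
  have h1 : inner κ N (frameOp κ N m f) e = 0 := by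
    rw [inner_frameOp_comm, horth _ (hlow e he)]
  rw [h, inner_add_left, inner_smul_left, horth e he, mul_zero, zero_add] at h1
  rw [h, eq_zero_of_inner_self hκ heN h1, add_zero]

theorem frameEigenvalue_pos {d N m n : ℕ} {κ : Fin (d + 1) → ℝ} (hκ : ∀ i, -1 < κ i)
    (hm : m ≤ N) : 0 < frameEigenvalue κ N m n := by
  have hl := lam_pos hκ
  have h1 := poch_pos hl N
  have h2 := poch_pos (show 0 < lam κ + m + n by positivity) (N - m)
  have h3 : 0 < (N - n).choose (m - n) := Nat.choose_pos (by omega)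
  rw [frameEigenvalue, avgFactor]
  positivity

theorem constD_mul_frameEigenvalue {d N m n : ℕ} {κ : Fin (d + 1) → ℝ} (hκ : ∀ i, -1 < κ i)
    (hnm : n ≤ m) (hm : m ≤ N) : constD κ n m N * frameEigenvalue κ N m n = 1 := by
  have hl := lam_pos hκ
  have h1 := poch_pos hl N
  have h2 := poch_pos hl (m + n)
  have h3 := poch_pos (show 0 < lam κ + m + n by positivity) (N - m)
  -- The eigenvalue carries (|κ|+d+1+m+n)_{N−m}, whereas D_n contains the quotient (|κ|+d+1)_{m+n} /
  -- (|κ|+d+1)_{N+n}.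
  have h4 : poch (lam κ) (N + n) = poch (lam κ) (m + n) * poch (lam κ + m + n) (N - m) := by
    rw [show N + n = (m + n) + (N - m) by omega, poch_add]
    push_cast
    rw [add_assoc]
  have h5 : ((N - n).choose (m - n) : ℝ) =
      (N - n).factorial / ((m - n).factorial * (N - m).factorial) := by
    rw [Nat.cast_choose ℝ (show m - n ≤ N - n by omega), show N - n - (m - n) = N - m by omega]
  rw [constD, frameEigenvalue, avgFactor, h4, h5, poch_neg_natCast_of_le hnm,
    poch_neg_natCast_of_le hm, poch_neg_natCast_of_le (hnm.trans hm)]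
  rw [mul_pow, ← pow_mul, mul_comm m 2, pow_mul, neg_one_sq, one_pow, one_mul]
  have h6 : ((-1 : ℝ) ^ n) ≠ 0 := by simp
  field_simp

/-- The formula has factors of alternating sign; positivity is read off from D_n being the
reciprocal of a positive eigenvalue. -/
theorem constD_pos {d N m n : ℕ} {κ : Fin (d + 1) → ℝ} (hκ : ∀ i, -1 < κ i)
    (hnm : n ≤ m) (hm : m ≤ N) : 0 < constD κ n m N :=
  pos_of_mul_pos_left (by rw [constD_mul_frameEigenvalue hκ hnm hm]; exact one_pos)
    (frameEigenvalue_pos hκ hm).le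

/-! ### Reproduction of the orthogonal spaces -/

theorem hahnQ_mem {d N n : ℕ} {κ : Fin (d + 1) → ℝ} (hκ : ∀ i, -1 < κ i) (hn : n ≤ N)
    (α : Fin (d + 1) → ℕ) : hahnQ κ N α n ∈ orthSpace κ N n :=
  Submodule.smul_mem _ _ (isProj_proj hκ hn _).1

/-- The part of m_α removed by the projection is orthogonal to V_n^d, so f does not see it. -/
theorem inner_hahnQ {d N n : ℕ} {κ : Fin (d + 1) → ℝ} (hκ : ∀ i, -1 < κ i) (hn : n ≤ N)
    (α : Fin (d + 1) → ℕ) {f : MvPolynomial (Fin d) ℝ} (hf : f ∈ orthSpace κ N n) :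
    inner κ N f (hahnQ κ N α n) =
      (∏ i, poch (κ i + 1) (α i))⁻¹ * inner κ N f (monicMonomial d N α) := by
  have h := (isProj_proj hκ hn (monicMonomial d N α)).2 f hf
  rw [inner_sub_left, sub_eq_zero] at h
  rw [inner_comm κ N f, hahnQ, inner_smul_left, ← h, inner_comm κ N f]

theorem sum_hahnQ {d N m n : ℕ} {κ : Fin (d + 1) → ℝ} (hκ : ∀ i, -1 < κ i) (hn : 0 < n)
    (hnm : n ≤ m) (hm : m ≤ N) {f : MvPolynomial (Fin d) ℝ} (hf : f ∈ orthSpace κ N n) :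
    constD κ n m N • ∑ α ∈ lattice d m,
      (weight κ α * inner κ N f (hahnQ κ N α n)) • hahnQ κ N α n = f := by
  have hnN := hnm.trans hm
  set g := ∑ α ∈ lattice d m, (weight κ α * inner κ N f (hahnQ κ N α n)) • hahnQ κ N α n with hg
  have hgV : g ∈ orthSpace κ N n :=
    Submodule.sum_mem _ fun α _ => Submodule.smul_mem _ _ (hahnQ_mem hκ hnN α)
  have h1 : ∀ r ∈ orthSpace κ N n, inner κ N g r = frameEigenvalue κ N m n * inner κ N f r := by
    intro r hr
    rw [← inner_smul_left, ← frameOp_eq_smul hκ hn hnm hm hf, inner_frameOp, hg, inner_sum_left]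
    refine Finset.sum_congr rfl fun α _ => ?_
    rw [inner_smul_left, inner_comm κ N _ r, inner_hahnQ hκ hnN α hf, inner_hahnQ hκ hnN α hr,
      mul_assoc]
  -- By `h1`, g and λ f have the same pairings with V_n^d, where λ is the eigenvalue. Testing
  -- against g − λ f itself, which lies in V_n^d, forces equality.
  have hmem := Submodule.sub_mem _ hgV (Submodule.smul_mem _ (frameEigenvalue κ N m n) hf)
  have h2 := h1 _ hmem
  rw [← inner_smul_left, ← sub_eq_zero, ← inner_sub_left] at h2
  have h3 := sub_eq_zero.1 (eq_zero_of_inner_self hκ (polySpace_mono hnN hmem.1) h2)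
  rw [h3, smul_smul, constD_mul_frameEigenvalue hκ hnm hm, one_smul]

theorem inner_eq_zero_of_ne {d N j n : ℕ} {κ : Fin (d + 1) → ℝ} (hjn : j ≠ n)
    {f g : MvPolynomial (Fin d) ℝ} (hf : f ∈ orthSpace κ N j) (hg : g ∈ orthSpace κ N n) :
    inner κ N f g = 0 := by
  have hf1 := (mem_restrictTotalDegree _ _ _ ).1 hf.1
  have hg1 := (mem_restrictTotalDegree _ _ _ ).1 hg.1
  rcases lt_or_gt_of_ne hjn with h | h
  · rw [inner_comm]
    exact hg.2 f (by omega)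
  · exact hf.2 g (by omega)

/-- One Gram–Schmidt step: g is the orthogonal projection of f onto Π_k^d, obtained by representing
⟨f, ·⟩ through the nondegenerate form there. -/
theorem exists_sub_mem_orthSpace {d N k : ℕ} {κ : Fin (d + 1) → ℝ} (hκ : ∀ i, -1 < κ i)
    (hk : k + 1 ≤ N) {f : MvPolynomial (Fin d) ℝ} (hf : f ∈ polySpace d (k + 1)) :
    ∃ g ∈ polySpace d k, f - g ∈ orthSpace κ N (k + 1) := by
  have hfin : FiniteDimensional ℝ (polySpace d k) := inferInstance
  have hnd : ((innerForm κ N).restrict (polySpace d k)).Nondegenerate := by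
    have key : ∀ f : polySpace d k, (innerForm κ N) f f = 0 → f = 0 := fun f hf =>
      Subtype.ext (eq_zero_of_inner_self hκ (polySpace_mono (by omega) f.2) hf)
    exact ⟨fun f hf => key f (hf f), fun f hf => key f (hf f)⟩
  let q := (LinearMap.BilinForm.toDual _ hnd).symm (innerForm κ N f ∘ₗ (polySpace d k).subtype)
  refine ⟨q, q.2, Submodule.sub_mem _ hf (polySpace_mono (Nat.le_succ k) q.2), fun r hr => ?_⟩
  have hr' : r ∈ polySpace d k := by
    rw [mem_restrictTotalDegree]; omega
  have h : inner κ N q r = inner κ N f r :=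
    LinearMap.BilinForm.apply_toDual_symm_apply (hB := hnd)
      (innerForm κ N f ∘ₗ (polySpace d k).subtype) ⟨r, hr'⟩
  rw [inner_sub_left, h, sub_self]

/-! ### The frame expansion and the Parseval identity. -/

/-- The right-hand side of the frame expansion. -/
noncomputable def frameExpansion {d : ℕ} (κ : Fin (d + 1) → ℝ) (N : ℕ) (m : ℕ → ℕ)
    (f : MvPolynomial (Fin d) ℝ) : MvPolynomial (Fin d) ℝ :=
  C (inner κ N f 1) + ∑ n ∈ Finset.Icc 1 N, constD κ n (m n) N •
    ∑ α ∈ lattice d (m n), (weight κ α * inner κ N f (hahnQ κ N α n)) • hahnQ κ N α n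

theorem frameExpansion_add {d : ℕ} (κ : Fin (d + 1) → ℝ) (N : ℕ) (m : ℕ → ℕ)
    (f g : MvPolynomial (Fin d) ℝ) :
    frameExpansion κ N m (f + g) = frameExpansion κ N m f + frameExpansion κ N m g := by
  simp only [frameExpansion, inner_add_left, mul_add, add_smul, Finset.sum_add_distrib, smul_add,
    map_add]
  abel

theorem one_mem_orthSpace {d : ℕ} (κ : Fin (d + 1) → ℝ) (N : ℕ) :
    (1 : MvPolynomial (Fin d) ℝ) ∈ orthSpace κ N 0 :=
  ⟨by rw [mem_restrictTotalDegree, totalDegree_one], fun _ hq => absurd hq (Nat.not_lt_zero _)⟩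

/-- Orthogonality of distinct V_n^d leaves only the level j: the constant term when j = 0, otherwise
the sum handled by `sum_hahnQ`. -/
theorem frameExpansion_of_mem_orthSpace {d N j : ℕ} {κ : Fin (d + 1) → ℝ} (hκ : ∀ i, -1 < κ i)
    {m : ℕ → ℕ} (hm : ∀ n ∈ Finset.Icc 1 N, n ≤ m n ∧ m n ≤ N) (hj : j ≤ N)
    {f : MvPolynomial (Fin d) ℝ} (hf : f ∈ orthSpace κ N j) : frameExpansion κ N m f = f := by
  have h0 : ∀ n ∈ Finset.Icc 1 N, n ≠ j → constD κ n (m n) N •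
      ∑ α ∈ lattice d (m n), (weight κ α * inner κ N f (hahnQ κ N α n)) • hahnQ κ N α n = 0 := by
    intro n hn hne
    rw [Finset.sum_eq_zero, smul_zero]
    intro α _
    rw [inner_eq_zero_of_ne hne.symm hf (hahnQ_mem hκ (Finset.mem_Icc.1 hn).2 α), mul_zero,
      zero_smul]
  rcases Nat.eq_zero_or_pos j with rfl | hpos
  · have hdeg : f.totalDegree = 0 :=
      Nat.le_zero.1 ((mem_restrictTotalDegree _ _ _).1 hf.1)
    obtain ⟨c, rfl⟩ : ∃ c, f = C c := ⟨_, totalDegree_eq_zero_iff_eq_C.1 hdeg⟩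
    rw [frameExpansion, Finset.sum_eq_zero fun n hn =>
      h0 n hn (by have := (Finset.mem_Icc.1 hn).1; omega), add_zero]
    have : (C c : MvPolynomial (Fin d) ℝ) = c • 1 := by rw [smul_eq_C_mul, mul_one]
    rw [this, inner_smul_left, inner_one_one hκ, mul_one, this]
  · have hjm := Finset.mem_Icc.2 ⟨hpos, hj⟩
    rw [frameExpansion, inner_eq_zero_of_ne hpos.ne' hf (one_mem_orthSpace κ N), map_zero,
      zero_add, Finset.sum_eq_single_of_mem j hjm h0,
      sum_hahnQ hκ hpos (hm j hjm).1 (hm j hjm).2 hf]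

/-- Additivity of the expansion allows peeling off the component in V_{k+1}^d and inducting on the
degree. -/
theorem frameExpansion_eq_self {d N k : ℕ} {κ : Fin (d + 1) → ℝ} (hκ : ∀ i, -1 < κ i)
    {m : ℕ → ℕ} (hm : ∀ n ∈ Finset.Icc 1 N, n ≤ m n ∧ m n ≤ N) (hk : k ≤ N)
    {f : MvPolynomial (Fin d) ℝ} (hf : f ∈ polySpace d k) : frameExpansion κ N m f = f := by
  induction k generalizing f with
  | zero =>
    exact frameExpansion_of_mem_orthSpace hκ hm hk
      ⟨hf, fun _ hq => absurd hq (Nat.not_lt_zero _)⟩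
  | succ k ih =>
    obtain ⟨g, hg, hfg⟩ := exists_sub_mem_orthSpace hκ hk hf
    rw [← sub_add_cancel f g, frameExpansion_add, ih (by omega) hg,
      frameExpansion_of_mem_orthSpace hκ hm hk hfg]

theorem inner_self_eq {d N : ℕ} {κ : Fin (d + 1) → ℝ} (hκ : ∀ i, -1 < κ i)
    {m : ℕ → ℕ} (hm : ∀ n ∈ Finset.Icc 1 N, n ≤ m n ∧ m n ≤ N)
    {f : MvPolynomial (Fin d) ℝ} (hf : f ∈ polySpace d N) :
    inner κ N f f = inner κ N f 1 ^ 2 + ∑ n ∈ Finset.Icc 1 N, constD κ n (m n) N *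
      ∑ α ∈ lattice d (m n), weight κ α * inner κ N f (hahnQ κ N α n) ^ 2 := by
  conv_lhs => arg 3; rw [← frameExpansion_eq_self hκ hm le_rfl hf]
  have : (C (inner κ N f 1) : MvPolynomial (Fin d) ℝ) = inner κ N f 1 • 1 := by
    rw [smul_eq_C_mul, mul_one]
  rw [frameExpansion, this, inner_add_left, inner_smul_left, inner_comm κ N 1, sq,
    inner_sum_left]
  congr 1
  refine Finset.sum_congr rfl fun n _ => ?_
  rw [inner_smul_left, inner_sum_left]
  congr 1
  refine Finset.sum_congr rfl fun α _ => ?_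
  rw [inner_smul_left, inner_comm κ N _ f]
  ring

theorem isTightFrame_frame {d N : ℕ} {κ : Fin (d + 1) → ℝ} (hκ : ∀ i, -1 < κ i)
    {m : ℕ → ℕ} (hm : ∀ n ∈ Finset.Icc 1 N, n ≤ m n ∧ m n ≤ N) :
    IsTightFrame (inner κ N) (polySpace d N) (frame κ N m) := by
  refine ⟨?_, fun f hf => ?_⟩
  · rintro (_ | ⟨n, α⟩)
    · exact polySpace_mono (Nat.zero_le N) (one_mem_orthSpace κ N).1
    · exact Submodule.smul_mem _ _
        (polySpace_mono n.2 (hahnQ_mem hκ (show n.1 + 1 ≤ N from n.2) α.1).1)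
  · rw [inner_self_eq hκ hm hf, Fintype.sum_option, Fintype.sum_sigma]
    congr 1
    -- Reindexing n = k + 1 matches the frame's storage of n − 1 in `Fin N`.
    rw [← Finset.Ico_add_one_right_eq_Icc, Finset.sum_Ico_eq_sum_range, Nat.add_sub_cancel,
      ← Fin.sum_univ_eq_sum_range (fun k => constD κ (1 + k) (m (1 + k)) N *
        ∑ α ∈ lattice d (m (1 + k)), weight κ α * inner κ N f (hahnQ κ N α (1 + k)) ^ 2)]
    refine Finset.sum_congr rfl fun n _ => ?_
    rw [add_comm 1 (n : ℕ), Finset.mul_sum, ← Finset.sum_coe_sort]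
    refine Finset.sum_congr rfl fun α _ => ?_
    have hn := hm (n + 1) (Finset.mem_Icc.2 ⟨Nat.le_add_left 1 n, n.2⟩)
    have hpos := (mul_pos (constD_pos hκ hn.1 hn.2) (weight_pos hκ α.1)).le
    rw [frame, inner_comm κ N f (_ • _), inner_smul_left, mul_pow, Real.sq_sqrt hpos,
      inner_comm κ N _ f, mul_assoc]

end HahnFrame

theorem theorem5p4 (d N : ℕ) (κ : Fin (d + 1) → ℝ) (hκ : ∀ i, -1 < κ i)
    (m : ℕ → ℕ) (hm : ∀ n ∈ Finset.Icc 1 N, n ≤ m n ∧ m n ≤ N) :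
    (∀ n ∈ Finset.Icc 1 N, ∀ α ∈ HahnFrame.lattice d (m n),
      0 < HahnFrame.constD κ n (m n) N * HahnFrame.weight κ α) ∧
    HahnFrame.IsTightFrame (HahnFrame.inner κ N) (HahnFrame.polySpace d N)
      (HahnFrame.frame κ N m) ∧
    ∀ f ∈ HahnFrame.polySpace d N,
      f = MvPolynomial.C (HahnFrame.inner κ N f 1) +
          ∑ n ∈ Finset.Icc 1 N, HahnFrame.constD κ n (m n) N •
            ∑ α ∈ HahnFrame.lattice d (m n),
              (HahnFrame.weight κ α * HahnFrame.inner κ N f (HahnFrame.hahnQ κ N α n)) •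
                HahnFrame.hahnQ κ N α n ∧
      HahnFrame.inner κ N f f = HahnFrame.inner κ N f 1 ^ 2 +
          ∑ n ∈ Finset.Icc 1 N, HahnFrame.constD κ n (m n) N *
            ∑ α ∈ HahnFrame.lattice d (m n),
              HahnFrame.weight κ α * HahnFrame.inner κ N f (HahnFrame.hahnQ κ N α n) ^ 2 := by
  exact ⟨fun n hn α _ => mul_pos (HahnFrame.constD_pos hκ (hm n hn).1 (hm n hn).2)
      (HahnFrame.weight_pos hκ α), HahnFrame.isTightFrame_frame hκ hm, fun f hf =>
    ⟨(HahnFrame.frameExpansion_eq_self hκ hm le_rfl hf).symm, HahnFrame.inner_self_eq hκ hm hf⟩⟩
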